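/- Let $\mathbb{F}_q$ be a finite field with $q$ elements. For $H \in \mathbb{F}_q^{m\times n}$ let $C_H=\{\mathbf{x}\in\mathbb{F}_q^n : H\mathbf{x}^t=\mathbf{0}\}$ be its parity-check code, and let $P_{\mathrm{ud}}(H,\varepsilon)$ be its unsuccessful decoding probability under unambiguous decoding over the $q$-ary erasure channel: a uniformly distributed codeword of $C_H$ is sent, each of its $n$ symbols is erased independently with probability $\varepsilon$, and the decoder succeeds if and only if the sent codeword is the only codeword that agrees with the received word in all non-erased positions. Let $\mathcal{R}_{m,n}$ be the set of all $m\times n$ matrices over $\mathbb{F}_q$ with the uniform probability, and let $P_{\mathrm{ud}}(\mathcal{R}_{m,n},\varepsilon)=\mathbb{E}[P_{\mathrm{ud}}(H,\varepsilon)]$ be the mean of $P_{\mathrm{ud}}(H,\varepsilon)$ over $H\in\mathcal{R}_{m,n}$. Theorem. Let $0<R<1$ and $0<\varepsilon<1$ be fixed. Then, as $n\to\infty$ and $H_n$ runs over the ensemble $\mathcal{R}_{(1-R)n,n}$, $$P_{\mathrm{ud}}(H_n,\varepsilon)-P_{\mathrm{ud}}(\mathcal{R}_{(1-R)n,n},\varepsilon)\to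 0\quad\text{with high probability},$$ that is, for every $\delta>0$ there are $c>0$ and $n_0>0$ such that $$\mathbb{P}\left(\left|P_{\mathrm{ud}}(H_n,\varepsilon)-P_{\mathrm{ud}}(\mathcal{R}_{(1-R)n,n},\varepsilon)\right|<\delta\right)>1-q^{-nc}\qquad\text{for all } n>n_0.$$ Here, when $(1-R)n$ is not an integer, the number of rows $(1-R)n$ may be replaced by either of the two integers next to it: $c$ and $n_0$ can be chosen such that the inequality holds for all $n>n_0$ and every non-negative integer number of rows $m$ with $|m-(1-R)n|<1$. -/

import Mathlib

namespace ErasureCode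

noncomputable section

open scoped Classical

/-! Unambiguous decoding over the `q`-ary erasure channel. A received word has type `Fin n → Option F`,
the value `none` marking an erased position. -/

/-- The word received when `c` is sent and exactly the positions in `E` are erased. -/
def erase {F : Type*} {n : ℕ} (E : Finset (Fin n)) (c : Fin n → F) : Fin n → Option F :=
  fun i => if i ∈ E then none else some (c i)

/-- The word `c` agrees with the received word `y` in all positions that are not erased. -/
def Consistent {F : Type*} {n : ℕ} (y : Fin n → Option F) (c : Fin n → F) : Prop :=
  ∀ i a, y i = some a → c i = a

/-- The unambiguous decoder: it outputs the codeword consistent with the received word if there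
is exactly one such codeword, and declares a failure (`none`) otherwise. -/
def udDecode {F : Type*} {n : ℕ} (C : Set (Fin n → F)) (y : Fin n → Option F) :
    Option (Fin n → F) :=
  if h : ∃! c, c ∈ C ∧ Consistent y c then some h.choose else none

/-- The unsuccessful decoding probability `P_ud(C, ε)` of a linear code `C` under unambiguous
decoding: the sent codeword is uniformly distributed on `C`, every position is erased
independently with probability `ε`, and decoding is unsuccessful unless the decoder outputs the
codeword that was sent. -/
def pud {F : Type*} [Field F] [Fintype F] {n : ℕ} (C : Submodule F (Fin n → F)) (ε : ℝ) : ℝ :=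
  (Fintype.card C : ℝ)⁻¹ * ∑ c : C, ∑ E : Finset (Fin n),
    if udDecode (C : Set (Fin n → F)) (erase E c) = some (c : Fin n → F) then 0
    else ε ^ E.card * (1 - ε) ^ (n - E.card)

/-- The parity-check code `C_H = {x | H xᵗ = 0}`. -/
def parityCheckCode {F : Type*} [Field F] {m n : ℕ} (H : Matrix (Fin m) (Fin n) F) :
    Submodule F (Fin n → F) :=
  LinearMap.ker H.mulVecLin

/-- `P_ud(H, ε) = P_ud(C_H, ε)`. -/
def pudMatrix {F : Type*} [Field F] [Fintype F] {m n : ℕ} (H : Matrix (Fin m) (Fin n) F)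
    (ε : ℝ) : ℝ :=
  pud (parityCheckCode H) ε

/-- The expectation of `X` over the ensemble of all `m × n` matrices over `F`, endowed with
uniform probability. -/
def ensembleMean (F : Type*) [Fintype F] (m n : ℕ) (X : Matrix (Fin m) (Fin n) F → ℝ) : ℝ :=
  (∑ H, X H) / (Fintype.card (Matrix (Fin m) (Fin n) F) : ℝ)

/-- The probability of the event `A` over the ensemble of all `m × n` matrices over `F`, endowed
with uniform probability. -/
def ensembleProb (F : Type*) [Fintype F] (m n : ℕ) (A : Matrix (Fin m) (Fin n) F → Prop) : ℝ :=
  ((Finset.univ.filter A).card : ℝ) / (Fintype.card (Matrix (Fin m) (Fin n) F) : ℝ)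

/-- The average unsuccessful decoding probability of the random matrix ensemble. -/
def pudEnsemble (F : Type*) [Field F] [Fintype F] (m n : ℕ) (ε : ℝ) : ℝ :=
  ensembleMean F m n (fun H => pudMatrix H ε)

/-- `C(E)`: the codewords of `C` that vanish outside `E`. -/
def subcode {F : Type*} [Field F] {n : ℕ} (C : Submodule F (Fin n → F)) (E : Finset (Fin n)) :
    Submodule F (Fin n → F) where
  carrier := {c | c ∈ C ∧ ∀ i, i ∉ E → c i = 0}
  add_mem' := fun {a b} ha hb =>
    ⟨C.add_mem ha.1 hb.1, fun i hi => by simp [ha.2 i hi, hb.2 i hi]⟩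
  zero_mem' := ⟨C.zero_mem, fun _ _ => rfl⟩
  smul_mem' := fun r a ha => ⟨C.smul_mem r ha.1, fun i hi => by simp [ha.2 i hi]⟩

/-- The number `I_i(C)` of incorrigible sets of size `i`. -/
def incorrigibleCount {F : Type*} [Field F] {n : ℕ} (C : Submodule F (Fin n → F)) (i : ℕ) : ℕ :=
  (Finset.univ.filter fun E : Finset (Fin n) => E.card = i ∧ subcode C E ≠ ⊥).card

theorem consistent_erase {F : Type*} {n : ℕ} (E : Finset (Fin n)) (c d : Fin n → F) :
    Consistent (erase E c) d ↔ ∀ i, i ∉ E → d i = c i := by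
  unfold Consistent erase
  constructor
  · intro h i hi
    exact h i (c i) (by simp [hi])
  · intro h i a hia
    by_cases hi : i ∈ E
    · simp [hi] at hia
    · simp only [hi, if_false, Option.some.injEq] at hia
      rw [← hia]
      exact h i hi

/-- Decoding succeeds exactly when the set of erased positions is not incorrigible. -/
theorem udDecode_erase_iff {F : Type*} [Field F] {n : ℕ} (C : Submodule F (Fin n → F))
    (E : Finset (Fin n)) (c : C) :
    udDecode (C : Set (Fin n → F)) (erase E c) = some (c : Fin n → F) ↔ subcode C E = ⊥ := by
  have hc : (c : Fin n → F) ∈ (C : Set (Fin n → F)) ∧ Consistent (erase E (c : Fin n → F)) c :=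
    ⟨c.2, (consistent_erase E _ _).2 fun _ _ => rfl⟩
  have key : (∃! d, d ∈ (C : Set (Fin n → F)) ∧ Consistent (erase E (c : Fin n → F)) d) ↔
      subcode C E = ⊥ := by
    constructor
    · intro h
      rw [Submodule.eq_bot_iff]
      intro x hx
      have h2 := h.unique hc (y₂ := (c : Fin n → F) + x) ⟨C.add_mem c.2 hx.1,
        (consistent_erase E _ _).2 fun i hi => by simp [hx.2 i hi]⟩
      simpa using h2
    · intro h
      refine ⟨c, hc, ?_⟩
      rintro d ⟨hd, hd2⟩
      rw [consistent_erase] at hd2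
      have : d - (c : Fin n → F) ∈ subcode C E :=
        ⟨C.sub_mem hd c.2, fun i hi => by simp [hd2 i hi]⟩
      rw [h, Submodule.mem_bot] at this
      exact sub_eq_zero.1 this
  rw [← key]
  unfold udDecode
  constructor
  · intro h
    by_contra hne
    rw [dif_neg hne] at h
    exact absurd h (by simp)
  · intro h
    rw [dif_pos h]
    exact congrArg some (h.unique h.choose_spec.1 hc)

/-- The unsuccessful decoding probability in terms of the incorrigible set distribution. -/
theorem pud_eq_sum {F : Type*} [Field F] [Fintype F] {n : ℕ} (C : Submodule F (Fin n → F))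
    (ε : ℝ) :
    pud C ε = ∑ i ∈ Finset.Icc 1 n,
      (incorrigibleCount C i : ℝ) * ε ^ i * (1 - ε) ^ (n - i) := by
  have hcard : (Fintype.card C : ℝ) ≠ 0 := Nat.cast_ne_zero.2 Fintype.card_ne_zero
  have hmem : ∀ E ∈ Finset.univ.filter (fun E : Finset (Fin n) => subcode C E ≠ ⊥),
      E.card ∈ Finset.Icc 1 n := by
    intro E hE
    rw [Finset.mem_filter] at hE
    rw [Finset.mem_Icc]
    refine ⟨?_, by simpa using Finset.card_le_univ E⟩
    rw [Nat.one_le_iff_ne_zero, Finset.card_ne_zero, Finset.nonempty_iff_ne_empty]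
    rintro rfl
    apply hE.2
    rw [Submodule.eq_bot_iff]
    intro x hx
    funext i
    exact hx.2 i (by simp)
  have h1 : pud C ε = ∑ E ∈ Finset.univ.filter (fun E : Finset (Fin n) => subcode C E ≠ ⊥),
      ε ^ E.card * (1 - ε) ^ (n - E.card) := by
    unfold pud
    simp only [udDecode_erase_iff]
    rw [Finset.sum_const, Finset.card_univ, nsmul_eq_mul, inv_mul_cancel_left₀ hcard,
      Finset.sum_filter]
    refine Finset.sum_congr rfl fun E _ => ?_
    by_cases h : subcode C E = ⊥ <;> simp [h]
  rw [h1, ← Finset.sum_fiberwise_of_maps_to hmem]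
  refine Finset.sum_congr rfl fun i _ => ?_
  rw [Finset.filter_filter]
  have h2 : ∀ E ∈ Finset.univ.filter
      (fun E : Finset (Fin n) => subcode C E ≠ ⊥ ∧ E.card = i),
      ε ^ E.card * (1 - ε) ^ (n - E.card) = ε ^ i * (1 - ε) ^ (n - i) := by
    intro E hE
    rw [(Finset.mem_filter.1 hE).2.2]
  rw [Finset.sum_congr rfl h2, Finset.sum_const, nsmul_eq_mul, mul_assoc]
  unfold incorrigibleCount
  simp only [and_comm]

end

end ErasureCode

namespace ErasureCode

noncomputable section

open scoped Classical

/-! ### Averages over the matrix ensemble -/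

section Ensemble

variable {F : Type*} [Fintype F] {m n : ℕ}

/-! By Chebyshev it suffices that the variance of `pudMatrix H ε` decays exponentially in `n`.
Decoding succeeds exactly when the columns of `H` at the erased positions `E` are independent, so
the variance is the average of `indepCov F m E E'` over two independent erasure patterns. Given that
the columns in `E ∩ E'` are independent, the events for `E` and `E'` are conditionally independent;
hence the covariance equals P(both) times the probability that the columns in `E ∩ E'` are dependent
(`indepCov_eq`). Two bounds follow: `t ^ |E ∩ E'| / t ^ m` for `1 ≤ t ≤ 2`, and `t ^ |E| / t ^ m`
for `0 < t ≤ 1`. Averaging gives `(1 + p * (t - 1)) ^ n / t ^ m` with `p = ε ^ 2` or `p = ε`. With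
`a = 1 - R`, a suitable `t` gives decay when `ε ^ 2 < a` in the first case and when `a < ε` in the
second. As `ε ^ 2 < ε`, every rate is covered, including `a = ε`, where the mean itself need not be
close to 0 or 1. -/

theorem ensembleMean_const_mul (c : ℝ) (X : Matrix (Fin m) (Fin n) F → ℝ) :
    ensembleMean F m n (fun H => c * X H) = c * ensembleMean F m n X := by
  unfold ensembleMean
  rw [← Finset.mul_sum, mul_div_assoc]

theorem ensembleMean_sum {ι : Type*} (s : Finset ι) (X : ι → Matrix (Fin m) (Fin n) F → ℝ) :
    ensembleMean F m n (fun H => ∑ i ∈ s, X i H) = ∑ i ∈ s, ensembleMean F m n (X i) := by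
  unfold ensembleMean
  rw [Finset.sum_comm, Finset.sum_div]

theorem ensembleMean_sub (X Y : Matrix (Fin m) (Fin n) F → ℝ) :
    ensembleMean F m n (fun H => X H - Y H) = ensembleMean F m n X - ensembleMean F m n Y := by
  unfold ensembleMean
  rw [Finset.sum_sub_distrib, sub_div]

theorem ensembleMean_mono {X Y : Matrix (Fin m) (Fin n) F → ℝ} (h : ∀ H, X H ≤ Y H) :
    ensembleMean F m n X ≤ ensembleMean F m n Y := by
  unfold ensembleMean
  gcongr with H
  exact h H

theorem ensembleMean_const [Nonempty F] (c : ℝ) :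
    ensembleMean F m n (fun _ => c) = c := by
  unfold ensembleMean
  have : (Fintype.card (Matrix (Fin m) (Fin n) F) : ℝ) ≠ 0 :=
    Nat.cast_ne_zero.2 (Fintype.card_ne_zero (α := Fin m → Fin n → F))
  rw [Finset.sum_const, Finset.card_univ, nsmul_eq_mul]
  field_simp

theorem ensembleProb_eq_mean (A : Matrix (Fin m) (Fin n) F → Prop) :
    ensembleProb F m n A = ensembleMean F m n (fun H => if A H then 1 else 0) := by
  unfold ensembleProb ensembleMean
  rw [Finset.sum_boole]

/-- Chebyshev's inequality over the matrix ensemble. -/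
theorem one_sub_le_ensembleProb [Nonempty F] (X : Matrix (Fin m) (Fin n) F → ℝ) (μ : ℝ)
    {δ : ℝ} (hδ : 0 < δ) :
    1 - ensembleMean F m n (fun H => (X H - μ) ^ 2) / δ ^ 2 ≤
      ensembleProb F m n (fun H => |X H - μ| < δ) := by
  rw [ensembleProb_eq_mean, div_eq_inv_mul, ← ensembleMean_const_mul]
  conv_lhs => rw [← ensembleMean_const (F := F) (m := m) (n := n) 1]
  rw [← ensembleMean_sub]
  refine ensembleMean_mono fun H => ?_
  split_ifs with h
  · have : 0 ≤ (δ ^ 2)⁻¹ * (X H - μ) ^ 2 := by positivity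
    linarith
  · rw [not_lt] at h
    have h2 : δ ^ 2 ≤ (X H - μ) ^ 2 := by
      rw [← sq_abs (X H - μ)]
      gcongr
    have : 1 ≤ (δ ^ 2)⁻¹ * (X H - μ) ^ 2 := by
      rw [← div_eq_inv_mul, le_div_iff₀ (by positivity)]
      linarith
    linarith

/-- Exchanging column `j` with `x` is an involution on pairs `(H, x)`. This makes resampling one
column harmless to the mean. -/
theorem sum_sum_updateCol (f : Matrix (Fin m) (Fin n) F → ℝ) (j : Fin n) :
    ∑ H : Matrix (Fin m) (Fin n) F, ∑ x : Fin m → F, f (H.updateCol j x) =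
      (Fintype.card F : ℝ) ^ m * ∑ H, f H := by
  let e : Matrix (Fin m) (Fin n) F × (Fin m → F) → Matrix (Fin m) (Fin n) F × (Fin m → F) :=
    fun p => (p.1.updateCol j p.2, fun i => p.1 i j)
  have he : Function.Involutive e := by
    rintro ⟨H, x⟩
    simp only [e, Prod.mk.injEq]
    constructor
    · ext i k
      by_cases hk : k = j
      · subst hk; simp
      · simp [hk]
    · ext i; simp
  rw [← Fintype.sum_prod_type' (fun H x => f (Matrix.updateCol H j x))]
  rw [Fintype.sum_bijective e he.bijective _ (fun p => f p.1) (fun _ => rfl)]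
  rw [Fintype.sum_prod_type]
  simp [Finset.mul_sum]

theorem ensembleMean_updateCol [Nonempty F] (f : Matrix (Fin m) (Fin n) F → ℝ) (j : Fin n) :
    ensembleMean F m n f = ensembleMean F m n
      (fun H => (∑ x : Fin m → F, f (H.updateCol j x)) / (Fintype.card F : ℝ) ^ m) := by
  have : (Fintype.card F : ℝ) ^ m ≠ 0 := by positivity
  unfold ensembleMean
  rw [← Finset.sum_div, sum_sum_updateCol, mul_div_cancel_left₀ _ this]

end Ensemble

/-! ### Decoding success as linear independence of columns -/

theorem col_updateCol {F : Type*} {m n : ℕ} (H : Matrix (Fin m) (Fin n) F) (j : Fin n) (x : Fin m → F) :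
    (H.updateCol j x).col = Function.update H.col j x := by
  ext k i
  by_cases hk : k = j
  · subst hk; simp
  · simp [hk]

variable {F : Type*} [Field F] {m n : ℕ}

/-- A codeword supported in `E` is a linear relation among the columns in `E`. -/
theorem subcode_parityCheckCode_eq_bot_iff (H : Matrix (Fin m) (Fin n) F) (E : Finset (Fin n)) :
    subcode (parityCheckCode H) E = ⊥ ↔ LinearIndepOn F H.col (E : Set (Fin n)) := by
  have hsum : ∀ c : Fin n → F, (∀ i, i ∉ E → c i = 0) →
      H.mulVec c = ∑ i ∈ E, c i • H.col i := by
    intro c hc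
    rw [Finset.sum_subset (Finset.subset_univ E) fun i _ hi => by simp [hc i hi]]
    ext k
    simp [Matrix.mulVec, dotProduct, mul_comm]
  rw [Submodule.eq_bot_iff, linearIndepOn_finset_iff]
  constructor
  · intro h f hf i hi
    have hz : ∀ k, k ∉ E → (fun k => if k ∈ E then f k else 0) k = 0 := fun k hk => by simp [hk]
    have := h (fun k => if k ∈ E then f k else 0) ⟨by
      change H.mulVec _ = 0
      rw [hsum _ hz, ← hf]
      exact Finset.sum_congr rfl fun k hk => by simp [hk], hz⟩
    simpa [hi] using congrFun this i
  · rintro h c ⟨hc, hz⟩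
    change H.mulVec c = 0 at hc
    rw [hsum c hz] at hc
    funext i
    by_cases hi : i ∈ E
    · exact h c hc i hi
    · exact hz i hi

/-- The indicator of the event that the columns of `H` with index in `E` are linearly
independent. -/
def indepIndicator (E : Finset (Fin n)) (H : Matrix (Fin m) (Fin n) F) : ℝ :=
  if LinearIndepOn F H.col (E : Set (Fin n)) then 1 else 0

theorem indepIndicator_nonneg (E : Finset (Fin n)) (H : Matrix (Fin m) (Fin n) F) :
    0 ≤ indepIndicator E H := by
  unfold indepIndicator; split_ifs <;> norm_num

theorem indepIndicator_le_one (E : Finset (Fin n)) (H : Matrix (Fin m) (Fin n) F) :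
    indepIndicator E H ≤ 1 := by
  unfold indepIndicator; split_ifs <;> norm_num

theorem indepIndicator_mul_of_subset {D E : Finset (Fin n)} (h : D ⊆ E)
    (H : Matrix (Fin m) (Fin n) F) :
    indepIndicator E H * indepIndicator D H = indepIndicator E H := by
  unfold indepIndicator
  by_cases hE : LinearIndepOn F H.col (E : Set (Fin n))
  · simp [hE, hE.mono (Finset.coe_subset.2 h)]
  · simp [hE]

theorem indepIndicator_eq_zero {E : Finset (Fin n)} (h : m < E.card)
    (H : Matrix (Fin m) (Fin n) F) : indepIndicator E H = 0 := by
  unfold indepIndicator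
  rw [if_neg]
  intro hE
  have := LinearIndependent.fintype_card_le_finrank hE
  simp at this
  omega

theorem indepIndicator_updateCol {E : Finset (Fin n)} {j : Fin n} (hj : j ∉ E)
    (H : Matrix (Fin m) (Fin n) F) (x : Fin m → F) :
    indepIndicator E (H.updateCol j x) = indepIndicator E H := by
  have : Set.EqOn (H.updateCol j x).col H.col E := by
    intro k hk
    have : k ≠ j := by rintro rfl; exact hj hk
    simp [col_updateCol, this]
  unfold indepIndicator
  rw [linearIndepOn_congr this]

/-! ### Probabilities of linear independence -/

variable [Fintype F]

/-- The new column must avoid the span of the others, which has `q ^ |S|` elements when they are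
independent. -/
theorem sum_indepIndicator_insert {S : Finset (Fin n)} {j : Fin n} (hj : j ∉ S)
    (H : Matrix (Fin m) (Fin n) F) :
    ∑ x : Fin m → F, indepIndicator (insert j S) (H.updateCol j x) =
      ((Fintype.card F : ℝ) ^ m - (Fintype.card F : ℝ) ^ S.card) * indepIndicator S H := by
  have key : ∀ x : Fin m → F, indepIndicator (insert j S) (H.updateCol j x) =
      indepIndicator S H *
        (1 - if x ∈ Submodule.span F (H.col '' (S : Set (Fin n))) then 1 else 0) := by
    intro x
    have him : (H.updateCol j x).col '' (S : Set (Fin n)) = H.col '' (S : Set (Fin n)) := by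
      refine Set.image_congr fun k hk => ?_
      have : k ≠ j := by rintro rfl; exact hj hk
      simp [col_updateCol, this]
    rw [← indepIndicator_updateCol hj H x]
    unfold indepIndicator
    rw [Finset.coe_insert, linearIndepOn_insert (by simpa using hj), him]
    have : (H.updateCol j x).col j = x := by simp [col_updateCol]
    rw [this]
    by_cases h1 : LinearIndepOn F (H.updateCol j x).col (S : Set (Fin n)) <;>
    by_cases h2 : x ∈ Submodule.span F (H.col '' (S : Set (Fin n))) <;> simp [h1, h2]
  simp only [key]
  rw [← Finset.mul_sum, Finset.sum_sub_distrib, Finset.sum_boole, mul_comm]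
  by_cases hS : LinearIndepOn F H.col (S : Set (Fin n))
  · congr 1
    congr 1
    · simp
    · have h1 : Module.finrank F (Submodule.span F (H.col '' (S : Set (Fin n)))) = S.card := by
        rw [Set.image_eq_range]
        have := finrank_span_eq_card hS
        simpa using this
      rw [← h1, ← Nat.cast_pow, ← Module.card_eq_pow_finrank, Fintype.card_subtype]
  · simp [indepIndicator, hS]

theorem ensembleMean_mul_indepIndicator_insert {S : Finset (Fin n)} {j : Fin n} (hj : j ∉ S)
    {B : Matrix (Fin m) (Fin n) F → ℝ} (hB : ∀ H x, B (H.updateCol j x) = B H) :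
    ensembleMean F m n (fun H => B H * indepIndicator (insert j S) H) =
      (1 - (Fintype.card F : ℝ) ^ S.card / (Fintype.card F : ℝ) ^ m) *
        ensembleMean F m n (fun H => B H * indepIndicator S H) := by
  have : (Fintype.card F : ℝ) ^ m ≠ 0 := by positivity
  rw [ensembleMean_updateCol _ j, ← ensembleMean_const_mul]
  congr 1
  funext H
  simp only [hB]
  rw [← Finset.mul_sum, sum_indepIndicator_insert hj]
  field_simp

theorem ensembleMean_mul_indepIndicator_union {S T : Finset (Fin n)} (hST : Disjoint S T)
    {B : Matrix (Fin m) (Fin n) F → ℝ} (hB : ∀ j ∈ T, ∀ H x, B (H.updateCol j x) = B H) :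
    ensembleMean F m n (fun H => B H * indepIndicator (S ∪ T) H) =
      (∏ k ∈ Finset.range T.card,
        (1 - (Fintype.card F : ℝ) ^ (S.card + k) / (Fintype.card F : ℝ) ^ m)) *
        ensembleMean F m n (fun H => B H * indepIndicator S H) := by
  induction T using Finset.induction_on with
  | empty => simp
  | insert j T hj ih =>
    rw [Finset.disjoint_insert_right] at hST
    rw [Finset.union_insert, ensembleMean_mul_indepIndicator_insert (by simp [hST.1, hj])
      (hB j (Finset.mem_insert_self j T)),
      ih hST.2 fun k hk => hB k (Finset.mem_insert_of_mem hk),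
      Finset.card_insert_of_notMem hj, Finset.prod_range_succ, Finset.card_union_of_disjoint hST.2]
    ring

variable (F m) in
/-- The probability that the columns with index in `E` are linearly independent. -/
def indepProb (E : Finset (Fin n)) : ℝ :=
  ensembleMean F m n (indepIndicator E)

theorem indepProb_nonneg (E : Finset (Fin n)) : 0 ≤ indepProb F m E := by
  have := ensembleMean_mono (F := F) (m := m) (indepIndicator_nonneg E)
  rwa [ensembleMean_const] at this

theorem indepProb_le_one (E : Finset (Fin n)) : indepProb F m E ≤ 1 := by
  have := ensembleMean_mono (F := F) (m := m) (indepIndicator_le_one E)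
  rwa [ensembleMean_const] at this

/-- Conditional independence given the columns in `E ∩ E'`, written without division so that it
survives a zero `indepProb`. Adding the columns of `E' \ E` to `E ∩ E'` costs the same product of
factors whether or not one also weights by `indepIndicator E`. -/
theorem ensembleMean_indepIndicator_mul_mul_indepProb (E E' : Finset (Fin n)) :
    ensembleMean F m n (fun H => indepIndicator E H * indepIndicator E' H) *
      indepProb F m (E ∩ E') = indepProb F m E * indepProb F m E' := by
  have hd : Disjoint (E ∩ E') (E' \ E) :=
    Finset.disjoint_left.2 fun i hi hi' => (Finset.mem_sdiff.1 hi').2 (Finset.mem_inter.1 hi).1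
  have hu : (E ∩ E') ∪ (E' \ E) = E' := by
    ext i; simp only [Finset.mem_union, Finset.mem_inter, Finset.mem_sdiff]; tauto
  have h1 := ensembleMean_mul_indepIndicator_union (F := F) (m := m) hd
    (B := indepIndicator E) fun j hj H x => indepIndicator_updateCol (Finset.mem_sdiff.1 hj).2 H x
  have h2 := ensembleMean_mul_indepIndicator_union (F := F) (m := m) hd
    (B := fun _ => 1) fun j hj H x => rfl
  simp only [hu, one_mul, indepIndicator_mul_of_subset Finset.inter_subset_left] at h1 h2
  unfold indepProb
  rw [h1]
  conv_rhs => rw [show ensembleMean F m n (indepIndicator E') = _ from h2]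
  rw [show ensembleMean F m n (fun H => indepIndicator E H) =
    ensembleMean F m n (indepIndicator E) from rfl]
  ring

theorem one_sub_indepProb_le (E : Finset (Fin n)) :
    1 - indepProb F m E ≤ (Fintype.card F : ℝ) ^ E.card / (Fintype.card F : ℝ) ^ m := by
  have hq : (2 : ℝ) ≤ Fintype.card F := by exact_mod_cast Fintype.one_lt_card (α := F)
  induction E using Finset.induction_on with
  | empty =>
    have : indepProb F m (∅ : Finset (Fin n)) = 1 := by
      have : (indepIndicator (F := F) (m := m) (∅ : Finset (Fin n))) = fun _ => 1 := by
        funext H; simp [indepIndicator]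
      rw [indepProb, this, ensembleMean_const]
    rw [this]
    simp
  | insert j S hj ih =>
    have h := ensembleMean_mul_indepIndicator_insert (F := F) (m := m) hj
      (B := fun _ => 1) fun H x => rfl
    simp only [one_mul] at h
    change indepProb F m (insert j S) = _ * indepProb F m S at h
    rw [h, Finset.card_insert_of_notMem hj, pow_succ]
    set r := (Fintype.card F : ℝ) ^ S.card / (Fintype.card F : ℝ) ^ m with hr
    have hr0 : 0 ≤ r := by positivity
    have h3 : (Fintype.card F : ℝ) ^ S.card * Fintype.card F / (Fintype.card F : ℝ) ^ m =
        r * Fintype.card F := by rw [hr]; ring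
    rw [h3]
    -- With `p = indepProb F m S`: `1 - (1 - r) * p = (1 - p) + r * p ≤ 2 * r ≤ r * q`.
    nlinarith [indepProb_le_one (F := F) (m := m) S, mul_le_mul_of_nonneg_left hq hr0]

/-! ### Covariance bounds -/

/-- The covariance of the events that the columns in `E`, respectively `E'`, are linearly
independent. -/
def indepCov (F : Type*) [Field F] [Fintype F] (m : ℕ) {n : ℕ} (E E' : Finset (Fin n)) : ℝ :=
  ensembleMean F m n (fun H =>
    (indepIndicator E H - indepProb F m E) * (indepIndicator E' H - indepProb F m E'))

theorem indepCov_eq (E E' : Finset (Fin n)) :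
    indepCov F m E E' = ensembleMean F m n (fun H => indepIndicator E H * indepIndicator E' H) *
      (1 - indepProb F m (E ∩ E')) := by
  have h : indepCov F m E E' =
      ensembleMean F m n (fun H => indepIndicator E H * indepIndicator E' H) -
        indepProb F m E * indepProb F m E' := by
    have : ∀ H : Matrix (Fin m) (Fin n) F,
        (indepIndicator E H - indepProb F m E) * (indepIndicator E' H - indepProb F m E') =
        indepIndicator E H * indepIndicator E' H - (indepProb F m E * indepIndicator E' H -
          (indepProb F m E * indepProb F m E' - indepProb F m E' * indepIndicator E H)) := by
      intro H; ring
    unfold indepCov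
    simp only [this]
    rw [ensembleMean_sub, ensembleMean_sub, ensembleMean_sub,
      ensembleMean_const_mul _ (indepIndicator E'), ensembleMean_const_mul _ (indepIndicator E),
      ensembleMean_const, ← indepProb, ← indepProb]
    ring
  rw [h, ← ensembleMean_indepIndicator_mul_mul_indepProb]
  ring

theorem indepCov_le_one_sub (E E' : Finset (Fin n)) :
    indepCov F m E E' ≤ 1 - indepProb F m (E ∩ E') := by
  rw [indepCov_eq]
  refine mul_le_of_le_one_left (sub_nonneg.2 (indepProb_le_one _)) ?_
  rw [← ensembleMean_const (F := F) (m := m) (n := n) 1]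
  exact ensembleMean_mono fun H => mul_le_one₀ (indepIndicator_le_one E H)
    (indepIndicator_nonneg E' H) (indepIndicator_le_one E' H)

/-- The dependence probability is at most `min 1 (q ^ (|E ∩ E'| - m))`; since `1 ≤ t ≤ 2 ≤ q`,
replacing `q` by `t` only weakens this. -/
theorem indepCov_le_pow_inter (E E' : Finset (Fin n)) {t : ℝ} (h1 : 1 ≤ t) (h2 : t ≤ 2) :
    indepCov F m E E' ≤ t ^ (E ∩ E').card / t ^ m := by
  have ht : 0 < t := by linarith
  have hq : (2 : ℝ) ≤ Fintype.card F := by exact_mod_cast Fintype.one_lt_card (α := F)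
  refine (indepCov_le_one_sub E E').trans ?_
  rcases le_total m (E ∩ E').card with h | h
  · have : 1 ≤ t ^ (E ∩ E').card / t ^ m := by
      rw [one_le_div (by positivity)]
      exact pow_le_pow_right₀ h1 h
    linarith [indepProb_nonneg (F := F) (m := m) (E ∩ E')]
  · refine (one_sub_indepProb_le _).trans ?_
    obtain ⟨k, hk⟩ := Nat.exists_eq_add_of_le h
    rw [hk, pow_add, pow_add, div_mul_cancel_left₀ (by positivity),
      div_mul_cancel_left₀ (by positivity)]
    gcongr
    linarith

/-- More than `m` columns are never independent, so the covariance vanishes for `|E| > m`; otherwise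
the right side is at least 1. -/
theorem indepCov_le_pow_card (E E' : Finset (Fin n)) {t : ℝ} (h0 : 0 < t) (h1 : t ≤ 1) :
    indepCov F m E E' ≤ t ^ E.card / t ^ m := by
  rcases lt_or_ge m E.card with h | h
  · rw [indepCov_eq]
    simp only [indepIndicator_eq_zero h, zero_mul, ensembleMean_const]
    positivity
  · have : 1 ≤ t ^ E.card / t ^ m := by
      rw [one_le_div (by positivity)]
      exact pow_le_pow_of_le_one h0.le h1 h
    linarith [indepCov_le_one_sub (F := F) (m := m) E E',
      indepProb_nonneg (F := F) (m := m) (E ∩ E')]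

/-! ### Generating functions of erasure patterns -/

/-- The probability that exactly the positions in `E` are erased. -/
def erasureWeight {n : ℕ} (ε : ℝ) (E : Finset (Fin n)) : ℝ :=
  ε ^ E.card * (1 - ε) ^ (n - E.card)

theorem erasureWeight_nonneg {ε : ℝ} (h0 : 0 ≤ ε) (h1 : ε ≤ 1) (E : Finset (Fin n)) :
    0 ≤ erasureWeight ε E :=
  mul_nonneg (pow_nonneg h0 _) (pow_nonneg (sub_nonneg.2 h1) _)

theorem sum_erasureWeight_mul_prod (ε : ℝ) (f : Fin n → ℝ) :
    ∑ E : Finset (Fin n), erasureWeight ε E * ∏ i ∈ E, f i = ∏ i, (ε * f i + (1 - ε)) := by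
  rw [Finset.prod_add, Finset.powerset_univ]
  refine Finset.sum_congr rfl fun E _ => ?_
  rw [Finset.prod_mul_distrib, Finset.prod_const, Finset.prod_const,
    ← Finset.compl_eq_univ_sdiff, Finset.card_compl, Fintype.card_fin, erasureWeight]
  ring

theorem sum_erasureWeight_mul_pow (ε t : ℝ) :
    ∑ E : Finset (Fin n), erasureWeight ε E * t ^ E.card = (1 + ε * (t - 1)) ^ n := by
  have := sum_erasureWeight_mul_prod (n := n) ε fun _ => t
  simp only [Finset.prod_const, Finset.card_univ, Fintype.card_fin] at this
  rw [this]
  ring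

theorem sum_erasureWeight (ε : ℝ) : ∑ E : Finset (Fin n), erasureWeight ε E = 1 := by
  simpa using sum_erasureWeight_mul_pow (n := n) ε 1

/-- Each position lies in both patterns with probability `ε ^ 2`, independently of the others. -/
theorem sum_sum_erasureWeight_mul_pow_inter (ε t : ℝ) :
    ∑ E : Finset (Fin n), ∑ E' : Finset (Fin n),
      erasureWeight ε E * erasureWeight ε E' * t ^ (E ∩ E').card =
      (1 + ε ^ 2 * (t - 1)) ^ n := by
  have h : ∀ E : Finset (Fin n), ∑ E' : Finset (Fin n),
      erasureWeight ε E * erasureWeight ε E' * t ^ (E ∩ E').card =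
      erasureWeight ε E * (1 + ε * (t - 1)) ^ E.card := by
    intro E
    simp only [mul_assoc]
    rw [← Finset.mul_sum]
    congr 1
    have h1 := sum_erasureWeight_mul_prod (n := n) ε fun i => if i ∈ E then t else 1
    have h2 : ∀ E' : Finset (Fin n), ∏ i ∈ E', (if i ∈ E then t else 1) = t ^ (E ∩ E').card := by
      intro E'
      rw [Finset.prod_ite, Finset.prod_const_one, mul_one, Finset.prod_const,
        Finset.filter_mem_eq_inter, Finset.inter_comm]
    simp only [h2] at h1
    rw [h1]
    have h3 : ∀ i : Fin n, ε * (if i ∈ E then t else 1) + (1 - ε) =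
        if i ∈ E then 1 + ε * (t - 1) else 1 := by
      intro i; split_ifs <;> ring
    simp only [h3]
    rw [Finset.prod_ite, Finset.prod_const_one, mul_one, Finset.prod_const]
    simp
  simp only [h]
  rw [sum_erasureWeight_mul_pow]
  ring

/-! ### Variance of the decoding probability -/

theorem pudMatrix_eq_one_sub (H : Matrix (Fin m) (Fin n) F) (ε : ℝ) :
    pudMatrix H ε = 1 - ∑ E : Finset (Fin n), erasureWeight ε E * indepIndicator E H := by
  have hcard : (Fintype.card (parityCheckCode H) : ℝ) ≠ 0 :=
    Nat.cast_ne_zero.2 Fintype.card_ne_zero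
  unfold pudMatrix pud
  simp only [udDecode_erase_iff, subcode_parityCheckCode_eq_bot_iff]
  rw [Finset.sum_const, Finset.card_univ, nsmul_eq_mul, inv_mul_cancel_left₀ hcard,
    eq_sub_iff_add_eq, ← Finset.sum_add_distrib]
  refine (Finset.sum_congr rfl fun E _ => ?_).trans (sum_erasureWeight (n := n) ε)
  unfold indepIndicator
  split_ifs <;> simp [erasureWeight]

theorem pudEnsemble_eq_one_sub (ε : ℝ) :
    pudEnsemble F m n ε = 1 - ∑ E : Finset (Fin n), erasureWeight ε E * indepProb F m E := by
  unfold pudEnsemble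
  simp only [pudMatrix_eq_one_sub]
  rw [ensembleMean_sub, ensembleMean_const, ensembleMean_sum]
  simp only [ensembleMean_const_mul]
  rfl

/-- The variance of the unsuccessful decoding probability over the matrix ensemble. -/
theorem ensembleMean_sq_pudMatrix_sub (ε : ℝ) :
    ensembleMean F m n (fun H => (pudMatrix H ε - pudEnsemble F m n ε) ^ 2) =
      ∑ E : Finset (Fin n), ∑ E' : Finset (Fin n),
        erasureWeight ε E * erasureWeight ε E' * indepCov F m E E' := by
  have h : ∀ H : Matrix (Fin m) (Fin n) F, (pudMatrix H ε - pudEnsemble F m n ε) ^ 2 =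
      ∑ E : Finset (Fin n), ∑ E' : Finset (Fin n), erasureWeight ε E * erasureWeight ε E' *
        ((indepIndicator E H - indepProb F m E) * (indepIndicator E' H - indepProb F m E')) := by
    intro H
    have : pudMatrix H ε - pudEnsemble F m n ε =
        -∑ E : Finset (Fin n), erasureWeight ε E * (indepIndicator E H - indepProb F m E) := by
      rw [pudMatrix_eq_one_sub, pudEnsemble_eq_one_sub]
      simp only [mul_sub, Finset.sum_sub_distrib]
      ring
    rw [this, neg_sq, sq, Finset.sum_mul_sum]
    refine Finset.sum_congr rfl fun E _ => Finset.sum_congr rfl fun E' _ => ?_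
    ring
  simp only [h]
  rw [ensembleMean_sum]
  refine Finset.sum_congr rfl fun E _ => ?_
  rw [ensembleMean_sum]
  refine Finset.sum_congr rfl fun E' _ => ?_
  rw [ensembleMean_const_mul]
  rfl

theorem ensembleMean_sq_le_of_one_le {ε t : ℝ} (h0 : 0 ≤ ε) (h1 : ε ≤ 1) (ht1 : 1 ≤ t)
    (ht2 : t ≤ 2) :
    ensembleMean F m n (fun H => (pudMatrix H ε - pudEnsemble F m n ε) ^ 2) ≤
      (1 + ε ^ 2 * (t - 1)) ^ n / t ^ m := by
  rw [ensembleMean_sq_pudMatrix_sub, ← sum_sum_erasureWeight_mul_pow_inter, Finset.sum_div]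
  refine Finset.sum_le_sum fun E _ => ?_
  rw [Finset.sum_div]
  refine Finset.sum_le_sum fun E' _ => ?_
  rw [mul_div_assoc]
  exact mul_le_mul_of_nonneg_left (indepCov_le_pow_inter E E' ht1 ht2)
    (mul_nonneg (erasureWeight_nonneg h0 h1 E) (erasureWeight_nonneg h0 h1 E'))

theorem ensembleMean_sq_le_of_le_one {ε t : ℝ} (h0 : 0 ≤ ε) (h1 : ε ≤ 1) (ht0 : 0 < t)
    (ht1 : t ≤ 1) :
    ensembleMean F m n (fun H => (pudMatrix H ε - pudEnsemble F m n ε) ^ 2) ≤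
      (1 + ε * (t - 1)) ^ n / t ^ m := by
  rw [ensembleMean_sq_pudMatrix_sub, ← sum_erasureWeight_mul_pow, Finset.sum_div]
  refine Finset.sum_le_sum fun E _ => ?_
  calc ∑ E' : Finset (Fin n), erasureWeight ε E * erasureWeight ε E' * indepCov F m E E'
      ≤ ∑ E' : Finset (Fin n), erasureWeight ε E * erasureWeight ε E' * (t ^ E.card / t ^ m) :=
        Finset.sum_le_sum fun E' _ =>
          mul_le_mul_of_nonneg_left (indepCov_le_pow_card E E' ht0 ht1)
            (mul_nonneg (erasureWeight_nonneg h0 h1 E) (erasureWeight_nonneg h0 h1 E'))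
    _ = erasureWeight ε E * t ^ E.card / t ^ m := by
        rw [← Finset.sum_mul, ← Finset.mul_sum, sum_erasureWeight]
        ring

/-! ### Exponential decay and conclusion -/

/-- The factor `exp |log t|` absorbs the rounding of `a * n` to `m`. -/
theorem pow_div_pow_le_exp {p a t : ℝ} (ht : 0 < t) (hb : 0 ≤ 1 + p * (t - 1)) {m n : ℕ}
    (hm : |(m : ℝ) - a * n| < 1) :
    (1 + p * (t - 1)) ^ n / t ^ m ≤
      Real.exp |Real.log t| * Real.exp (-((a * Real.log t - p * (t - 1)) * n)) := by
  have h1 : (1 + p * (t - 1)) ^ n ≤ Real.exp (n * (p * (t - 1))) := by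
    rw [Real.exp_nat_mul]
    gcongr
    linarith [Real.add_one_le_exp (p * (t - 1))]
  have h2 : t ^ m = Real.exp (m * Real.log t) := by rw [Real.exp_nat_mul, Real.exp_log ht]
  have h3 : -|Real.log t| ≤ (m - a * n) * Real.log t := by
    have : |(m - a * n) * Real.log t| ≤ |Real.log t| := by
      rw [abs_mul]
      exact mul_le_of_le_one_left (abs_nonneg _) hm.le
    exact (neg_le_neg this).trans (neg_abs_le _)
  calc (1 + p * (t - 1)) ^ n / t ^ m
      ≤ Real.exp (n * (p * (t - 1))) / Real.exp (m * Real.log t) := by rw [h2]; gcongr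
    _ ≤ _ := by
        rw [← Real.exp_sub, ← Real.exp_add, Real.exp_le_exp]
        linarith

/-- For `p > 0` the sign condition says that `t` lies strictly between 1 and `a / p`; then `log t ≥
1 - 1 / t` suffices. -/
theorem mul_sub_one_lt_mul_log {p a t : ℝ} (ha : 0 ≤ a) (ht : 0 < t)
    (h : 0 < (t - 1) * (a - p * t)) : p * (t - 1) < a * Real.log t := by
  have h1 : a * (1 - t⁻¹) ≤ a * Real.log t := by
    gcongr
    exact Real.one_sub_inv_le_log_of_pos ht
  have h2 : a * (1 - t⁻¹) - p * (t - 1) = (t - 1) * (a - p * t) / t := by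
    field_simp
  have h3 : 0 < (t - 1) * (a - p * t) / t := by positivity
  linarith

theorem exists_variance_le_exp (F : Type*) [Field F] [Fintype F] {a ε : ℝ} (ha : 0 < a)
    (hε0 : 0 < ε) (hε1 : ε < 1) :
    ∃ K κ : ℝ, 0 < K ∧ 0 < κ ∧ ∀ m n : ℕ, |(m : ℝ) - a * n| < 1 →
      ensembleMean F m n (fun H => (pudMatrix H ε - pudEnsemble F m n ε) ^ 2) ≤
        K * Real.exp (-(κ * n)) := by
  have hsq : ε ^ 2 < ε := by nlinarith
  have hsq0 : 0 < ε ^ 2 := by positivity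
  rcases lt_or_ge (ε ^ 2) a with h | h
  · have h1 : 1 < min 2 (a / ε ^ 2) := lt_min (by norm_num) ((one_lt_div hsq0).2 h)
    obtain ⟨t, ht1, ht2⟩ := exists_between h1
    rw [lt_min_iff, lt_div_iff₀ hsq0] at ht2
    refine ⟨Real.exp |Real.log t|, a * Real.log t - ε ^ 2 * (t - 1), Real.exp_pos _,
      sub_pos.2 (mul_sub_one_lt_mul_log ha.le (by linarith)
        (mul_pos (by linarith) (by linarith [ht2.2]))), fun m n hm => ?_⟩
    exact (ensembleMean_sq_le_of_one_le hε0.le hε1.le ht1.le ht2.1.le).trans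
      (pow_div_pow_le_exp (by linarith) (by nlinarith) hm)
  · have h1 : a / ε < 1 := (div_lt_one hε0).2 (by linarith)
    obtain ⟨t, ht1, ht2⟩ := exists_between h1
    have ht0 : 0 < t := (div_pos ha hε0).trans ht1
    rw [div_lt_iff₀ hε0] at ht1
    refine ⟨Real.exp |Real.log t|, a * Real.log t - ε * (t - 1), Real.exp_pos _,
      sub_pos.2 (mul_sub_one_lt_mul_log ha.le ht0
        (mul_pos_of_neg_of_neg (by linarith) (by linarith))), fun m n hm => ?_⟩
    exact (ensembleMean_sq_le_of_le_one hε0.le hε1.le ht0 ht2.le).trans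
      (pow_div_pow_le_exp ht0 (by nlinarith) hm)

end

end ErasureCode

theorem theorem4 {F : Type*} [Field F] [Fintype F] (R : ℝ) (hR0 : 0 < R) (hR1 : R < 1)
    (ε : ℝ) (hε0 : 0 < ε) (hε1 : ε < 1) (δ : ℝ) (hδ : 0 < δ) :
    ∃ c : ℝ, 0 < c ∧ ∃ n₀ : ℕ, 0 < n₀ ∧ ∀ n : ℕ, n₀ < n →
      ∀ m : ℕ, |(m : ℝ) - (1 - R) * (n : ℝ)| < 1 →
        ErasureCode.ensembleProb F m n (fun H =>
            |ErasureCode.pudMatrix H ε - ErasureCode.pudEnsemble F m n ε| < δ) >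
          1 - (Fintype.card F : ℝ) ^ (-((n : ℝ) * c)) := by
  obtain ⟨K, κ, hK, hκ, hvar⟩ :=
    ErasureCode.exists_variance_le_exp F (sub_pos.2 hR1) hε0 hε1
  have hq : (1 : ℝ) < Fintype.card F := by exact_mod_cast Fintype.one_lt_card (α := F)
  have hlog : 0 < Real.log (Fintype.card F) := Real.log_pos hq
  obtain ⟨N, hN⟩ := exists_nat_gt (K / δ ^ 2 / (κ / 2))
  -- This `c` makes `q ^ (-(n * c))` equal to `exp (-(κ / 2 * n))`; the other half of the exponent
  -- `κ` absorbs `K / δ ^ 2` once `n > N`.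
  refine ⟨κ / 2 / Real.log (Fintype.card F), by positivity, N + 1, N.succ_pos,
    fun n hn m hm => ?_⟩
  have hcheb := ErasureCode.one_sub_le_ensembleProb (F := F) (m := m) (n := n)
    (fun H => ErasureCode.pudMatrix H ε) (ErasureCode.pudEnsemble F m n ε) hδ
  have hpow : (Fintype.card F : ℝ) ^ (-((n : ℝ) * (κ / 2 / Real.log (Fintype.card F)))) =
      Real.exp (-(κ / 2 * n)) := by
    rw [Real.rpow_def_of_pos (by linarith)]
    congr 1
    field_simp
  have hn' : (N : ℝ) < n := by exact_mod_cast (Nat.lt_succ_self N).trans hn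
  have hlarge : K / δ ^ 2 < Real.exp (κ / 2 * n) := by
    have h1 := (div_lt_iff₀ (by positivity)).1 (hN.trans hn')
    linarith [Real.add_one_le_exp (κ / 2 * n)]
  have hsmall : ErasureCode.ensembleMean F m n
      (fun H => (ErasureCode.pudMatrix H ε - ErasureCode.pudEnsemble F m n ε) ^ 2) / δ ^ 2 <
        Real.exp (-(κ / 2 * n)) := by
    calc _ ≤ K * Real.exp (-(κ * n)) / δ ^ 2 := by gcongr; exact hvar m n hm
      _ = K / δ ^ 2 * Real.exp (-(κ * n)) := by ring
      _ < Real.exp (κ / 2 * n) * Real.exp (-(κ * n)) := by gcongr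
      _ = Real.exp (-(κ / 2 * n)) := by rw [← Real.exp_add]; congr 1; ring
  rw [hpow]
  linarith
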